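/- Let $N,M\ge 1$ be integers and let $q:\mathbb Z^2\to\mathbb R$ be $(N,M)$-periodic, i.e. $q_{n+N,m}=q_{n,m}$ and $q_{n,m+M}=q_{n,m}$ for all $n,m\in\mathbb Z$. Let $\mathcal J_1$ be the discrete Schrödinger operator on the complex Hilbert space $\ell^2(\mathbb Z^2)$, the bounded self-adjoint operator given by $$(\mathcal J_1y)_{n,m}=y_{n,m-1}+y_{n,m+1}+y_{n-1,m}+y_{n+1,m}+q_{n,m}y_{n,m},\qquad n,m\in\mathbb Z.$$ Then the Lebesgue measure of its spectrum $\sigma(\mathcal J_1)\subset\mathbb R$ satisfies $$\operatorname{mes}(\sigma(\mathcal J_1))\le 4(N+M).$$ Moreover, for $N=M=1$ and $q$ constant, equality holds: $\operatorname{mes}(\sigma(\mathcal J_1))=8=4(1+1)$. -/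

import Mathlib

open scoped ENNReal

noncomputable section

namespace DiscreteSchrodinger

/-- The complex Hilbert space `ℓ²(ℤ²)`. -/
abbrev L2 : Type := lp (fun _ : ℤ × ℤ => ℂ) 2

/-- `q` is `(N, M)`-periodic: it has period `N` in the first variable and period `M` in the
second one. -/
def IsPeriodic (N M : ℕ) (q : ℤ → ℤ → ℝ) : Prop :=
  (∀ n m : ℤ, q (n + N) m = q n m) ∧ (∀ n m : ℤ, q n (m + M) = q n m)

/-- `q` is a bounded sequence. -/
def IsBoundedSeq (q : ℤ → ℤ → ℝ) : Prop := ∃ C : ℝ, ∀ n m : ℤ, |q n m| ≤ C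

theorem IsPeriodic.isBoundedSeq {N M : ℕ} {q : ℤ → ℤ → ℝ} (hq : IsPeriodic N M q)
    (hN : 0 < N) (hM : 0 < M) : IsBoundedSeq q := by
  have hN' : (0 : ℤ) < N := by exact_mod_cast hN
  have hM' : (0 : ℤ) < M := by exact_mod_cast hM
  have h1 : ∀ n m : ℤ, q (n % N) m = q n m := fun n m => by
    have hp : Function.Periodic (fun n => q n m) (N : ℤ) := fun n => hq.1 n m
    have h := hp.sub_zsmul_eq (x := n) (n / N)
    simp only [smul_eq_mul] at h
    rw [Int.emod_def, mul_comm]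
    exact h
  have h2 : ∀ n m : ℤ, q n (m % M) = q n m := fun n m => by
    have hp : Function.Periodic (fun m => q n m) (M : ℤ) := fun m => hq.2 n m
    have h := hp.sub_zsmul_eq (x := m) (m / M)
    simp only [smul_eq_mul] at h
    rw [Int.emod_def, mul_comm]
    exact h
  refine ⟨∑ i ∈ Finset.Ico (0 : ℤ) N ×ˢ Finset.Ico (0 : ℤ) M, |q i.1 i.2|, fun n m => ?_⟩
  have hmem : (n % (N : ℤ), m % (M : ℤ)) ∈ Finset.Ico (0 : ℤ) N ×ˢ Finset.Ico (0 : ℤ) M := by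
    simp only [Finset.mem_product, Finset.mem_Ico]
    exact ⟨⟨Int.emod_nonneg _ hN'.ne', Int.emod_lt_of_pos _ hN'⟩,
      ⟨Int.emod_nonneg _ hM'.ne', Int.emod_lt_of_pos _ hM'⟩⟩
  have h := Finset.single_le_sum (f := fun i : ℤ × ℤ => |q i.1 i.2|)
    (fun i _ => abs_nonneg _) hmem
  simpa only [h1, h2] using h

theorem summable_sq (u : L2) : Summable fun p : ℤ × ℤ => ‖u p‖ ^ (2 : ℕ) := by
  have h := (memℓp_gen_iff (p := (2 : ℝ≥0∞)) (by norm_num)).1 (lp.memℓp u)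
  simpa using h

theorem memℓp_two {f : ℤ × ℤ → ℂ} (h : Summable fun p => ‖f p‖ ^ (2 : ℕ)) :
    Memℓp (E := fun _ : ℤ × ℤ => ℂ) f 2 := by
  refine (memℓp_gen_iff (p := (2 : ℝ≥0∞)) (by norm_num)).2 ?_
  simpa using h

theorem norm_sq_eq (u : L2) : ‖u‖ ^ (2 : ℕ) = ∑' p : ℤ × ℤ, ‖u p‖ ^ (2 : ℕ) := by
  have h := lp.norm_rpow_eq_tsum (p := (2 : ℝ≥0∞)) (by norm_num) u
  simpa using h

/-- The translation `(shift a u)(p) = u (p + a)` on `ℓ²(ℤ²)`. -/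
def shift (a : ℤ × ℤ) : L2 →L[ℂ] L2 :=
  LinearMap.mkContinuous
    { toFun := fun u => ⟨fun p => u (p + a),
        memℓp_two ((Equiv.addRight a).summable_iff.2 (summable_sq u))⟩
      map_add' := fun _ _ => rfl
      map_smul' := fun _ _ => rfl } 1 (by
    intro u
    rw [one_mul]
    refine (sq_le_sq₀ (norm_nonneg _) (norm_nonneg _)).1 (le_of_eq ?_)
    rw [norm_sq_eq, norm_sq_eq]
    exact (Equiv.addRight a).tsum_eq (fun p => ‖u p‖ ^ (2 : ℕ)))

theorem summable_mul {q : ℤ → ℤ → ℝ} {C : ℝ} (hC : ∀ n m : ℤ, |q n m| ≤ C) (u : L2) :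
    (∀ p : ℤ × ℤ, ‖(q p.1 p.2 : ℂ) * u p‖ ^ (2 : ℕ) ≤ C ^ 2 * ‖u p‖ ^ (2 : ℕ)) ∧
      Summable fun p : ℤ × ℤ => ‖(q p.1 p.2 : ℂ) * u p‖ ^ (2 : ℕ) := by
  have key : ∀ p : ℤ × ℤ, ‖(q p.1 p.2 : ℂ) * u p‖ ^ (2 : ℕ) ≤ C ^ 2 * ‖u p‖ ^ (2 : ℕ) := by
    intro p
    rw [norm_mul, mul_pow, Complex.norm_real, Real.norm_eq_abs]
    gcongr
    exact hC _ _
  exact ⟨key, Summable.of_nonneg_of_le (fun _ => by positivity) key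
    ((summable_sq u).mul_left _)⟩

/-- Multiplication by a bounded real sequence `q` on `ℓ²(ℤ²)`. -/
def mulOp (q : ℤ → ℤ → ℝ) (hq : IsBoundedSeq q) : L2 →L[ℂ] L2 :=
  LinearMap.mkContinuousOfExistsBound
    { toFun := fun u => ⟨fun p => (q p.1 p.2 : ℂ) * u p,
        memℓp_two (summable_mul hq.choose_spec u).2⟩
      map_add' := fun u v => by
        ext p
        exact mul_add _ _ _
      map_smul' := fun c u => by
        ext p
        exact mul_left_comm _ _ _ } (by
    obtain ⟨C, hC⟩ := hq
    have hC0 : 0 ≤ C := (abs_nonneg _).trans (hC 0 0)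
    refine ⟨C, fun u => ?_⟩
    refine (sq_le_sq₀ (norm_nonneg _) (by positivity)).1 ?_
    rw [mul_pow, norm_sq_eq, norm_sq_eq, ← tsum_mul_left]
    exact (summable_mul hC u).2.tsum_le_tsum (summable_mul hC u).1
      ((summable_sq u).mul_left _))

/-- The two-dimensional discrete Schrödinger operator with bounded real potential `q`, as a
bounded operator on `ℓ²(ℤ²)`. -/
def schrodinger (q : ℤ → ℤ → ℝ) (hq : IsBoundedSeq q) : L2 →L[ℂ] L2 :=
  shift (0, -1) + shift (0, 1) + shift (-1, 0) + shift (1, 0) + mulOp q hq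

/-- The pointwise formula for the operator. -/
theorem schrodinger_apply (q : ℤ → ℤ → ℝ) (hq : IsBoundedSeq q) (u : L2) (n m : ℤ) :
    schrodinger q hq u (n, m) =
      u (n, m - 1) + u (n, m + 1) + u (n - 1, m) + u (n + 1, m) + (q n m : ℂ) * u (n, m) := by
  have h : schrodinger q hq u (n, m) =
      u ((n, m) + (0, -1)) + u ((n, m) + (0, 1)) + u ((n, m) + (-1, 0)) + u ((n, m) + (1, 0)) +
        (q n m : ℂ) * u (n, m) := rfl
  rw [h]
  simp only [Prod.mk_add_mk, add_zero, sub_eq_add_neg]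

/-- The operator is symmetric, hence self-adjoint, so that its spectrum is a set of reals. -/
theorem schrodinger_isSelfAdjoint (q : ℤ → ℤ → ℝ) (hq : IsBoundedSeq q) :
    IsSelfAdjoint (schrodinger q hq) := by
  have hs : ∀ (a : ℤ × ℤ) (u v : L2), inner ℂ (shift a u) v = inner ℂ u (shift (-a) v) := by
    intro a u v
    rw [lp.inner_eq_tsum, lp.inner_eq_tsum,
      ← (Equiv.addRight a).tsum_eq (fun p => inner ℂ (u p) (shift (-a) v p))]
    refine tsum_congr fun p => ?_
    have h : shift (-a) v (p + a) = v (p + a + -a) := rfl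
    change inner ℂ (u (p + a)) (v p) = inner ℂ (u (p + a)) (shift (-a) v (p + a))
    rw [h, add_neg_cancel_right]
  have hm : ∀ u v : L2, inner ℂ (mulOp q hq u) v = inner ℂ u (mulOp q hq v) := by
    intro u v
    rw [lp.inner_eq_tsum, lp.inner_eq_tsum]
    refine tsum_congr fun p => ?_
    change inner ℂ ((q p.1 p.2 : ℂ) * u p) (v p) = inner ℂ (u p) ((q p.1 p.2 : ℂ) * v p)
    simp only [RCLike.inner_apply, map_mul, Complex.conj_ofReal]
    ring
  rw [ContinuousLinearMap.isSelfAdjoint_iff_isSymmetric]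
  intro u v
  change inner ℂ (schrodinger q hq u) v = inner ℂ u (schrodinger q hq v)
  simp only [schrodinger, add_apply, inner_add_left, inner_add_right, hs, hm,
    Prod.neg_mk, neg_neg, neg_zero]
  ring

/-- The spectrum of a (self-adjoint) bounded operator on `ℓ²(ℤ²)`, as a subset of `ℝ`. -/
def realSpectrum (T : L2 →L[ℂ] L2) : Set ℝ := {x : ℝ | (x : ℂ) ∈ spectrum ℂ T}

end DiscreteSchrodinger

end

/-!
Cut `ℤ²` into `N × M` cells.  For a bond joining the sites `p` and `p'` of two different cells,
`-|u p|² - |u p'|² ≤ 2 re (conj (u p) * u p') ≤ |u p|² + |u p'|²`, and the two defects are the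
squares `|u p ± u p'|²`.  Replacing each such bond by on-site terms `-1` resp. `1` thus brackets the
operator between two operators that decouple into copies of one finite Hermitian block each,
`A ≤ B`.  With `αᵢ` and `βᵢ` the ordered eigenvalues of `A` and `B`, Weyl's monotonicity gives
`αᵢ ≤ βᵢ`.  A real `x` outside every `[αᵢ, βᵢ]` has as many `αᵢ` as `βᵢ` above it, so the
form of the operator minus `x` is negative on the low part of the upper blocks and positive on the
high part of the lower ones, and these two subspaces span: `x` is not in the spectrum.  Hence the
spectrum has measure at most `∑ (βᵢ - αᵢ) = tr (B - A)`, which is twice the number `2 (N + M)` of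
directed bonds leaving a cell.

For a constant potential `c`, plane waves damped exponentially are approximate eigenvectors, which
puts every `c + 4 cos θ` into the spectrum.
-/

namespace DiscreteSchrodinger

open scoped ComplexOrder InnerProductSpace

section SelfAdjoint

variable {𝕜 H : Type*} [RCLike 𝕜] [NormedAddCommGroup H] [InnerProductSpace 𝕜 H] [CompleteSpace H]
  {T : H →L[𝕜] H}

theorem isUnit_of_isSelfAdjoint_of_antilipschitzWith (hT : IsSelfAdjoint T) {K : NNReal}
    (hK : AntilipschitzWith K T) : IsUnit T := by
  rw [ContinuousLinearMap.isUnit_iff_bijective,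
    ContinuousLinearMap.bijective_iff_dense_range_and_antilipschitz]
  refine ⟨?_, K, hK⟩
  rw [Submodule.topologicalClosure_eq_top_iff, ContinuousLinearMap.orthogonal_range,
    hT.adjoint_eq, LinearMap.ker_eq_bot]
  exact hK.injective

theorem isUnit_of_forall_exists_add (hT : IsSelfAdjoint T) {ε : ℝ} (hε : 0 < ε)
    (h : ∀ u, ∃ v w, v + w = u ∧ RCLike.re ⟪v, T v⟫_𝕜 ≤ -(ε * ‖v‖ ^ 2) ∧
      ε * ‖w‖ ^ 2 ≤ RCLike.re ⟪w, T w⟫_𝕜) : IsUnit T := by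
  suffices hbound : ∃ c > 0, ∀ u, c * ‖u‖ ≤ ‖T u‖ by
    obtain ⟨K, hK⟩ := antilipschitzWith_iff_exists_mul_le_norm.2 hbound
    exact isUnit_of_isSelfAdjoint_of_antilipschitzWith hT hK
  refine ⟨ε / 2, half_pos hε, fun u => ?_⟩
  obtain ⟨v, w, rfl, hv, hw⟩ := h u
  have hsymm : RCLike.re ⟪w, T v⟫_𝕜 = RCLike.re ⟪v, T w⟫_𝕜 := by
    rw [inner_re_symm]
    exact congrArg RCLike.re (hT.isSymmetric v w)
  have htest : RCLike.re ⟪w - v, T (v + w)⟫_𝕜 =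
      RCLike.re ⟪w, T w⟫_𝕜 - RCLike.re ⟪v, T v⟫_𝕜 := by
    simp only [map_add, inner_sub_left, inner_add_right, map_sub, hsymm]
    ring
  have hcauchy : RCLike.re ⟪w - v, T (v + w)⟫_𝕜 ≤ (‖v‖ + ‖w‖) * ‖T (v + w)‖ := by
    rw [add_comm ‖v‖]
    exact (re_inner_le_norm _ _).trans (by gcongr; exact norm_sub_le w v)
  have hquad : (‖v‖ + ‖w‖) * (ε / 2 * (‖v‖ + ‖w‖)) ≤ (‖v‖ + ‖w‖) * ‖T (v + w)‖ := by
    nlinarith [mul_nonneg hε.le (sq_nonneg (‖v‖ - ‖w‖))]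
  have htri := norm_add_le v w
  rcases (add_nonneg (norm_nonneg v) (norm_nonneg w)).eq_or_lt with h0 | h0
  · rw [← h0] at htri
    exact (mul_nonpos_of_nonneg_of_nonpos (half_pos hε).le htri).trans (norm_nonneg _)
  · exact (mul_le_mul_of_nonneg_left htri (half_pos hε).le).trans (le_of_mul_le_mul_left hquad h0)

theorem ofReal_notMem_spectrum_of_forall_exists_add (hT : IsSelfAdjoint T) {x ε : ℝ} (hε : 0 < ε)
    (h : ∀ u, ∃ v w, v + w = u ∧ RCLike.re ⟪v, T v⟫_𝕜 ≤ (x - ε) * ‖v‖ ^ 2 ∧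
      (x + ε) * ‖w‖ ^ 2 ≤ RCLike.re ⟪w, T w⟫_𝕜) : (x : 𝕜) ∉ spectrum 𝕜 T := by
  have hsa : IsSelfAdjoint (T - algebraMap 𝕜 (H →L[𝕜] H) (x : 𝕜)) :=
    hT.sub ((show IsSelfAdjoint (x : 𝕜) from RCLike.conj_ofReal x).algebraMap _)
  have hre (v : H) : RCLike.re ⟪v, (T - algebraMap 𝕜 (H →L[𝕜] H) (x : 𝕜)) v⟫_𝕜 =
      RCLike.re ⟪v, T v⟫_𝕜 - x * ‖v‖ ^ 2 := by
    rw [sub_apply, inner_sub_right, map_sub, Algebra.algebraMap_eq_smul_one, smul_apply,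
      one_apply_eq_self, inner_smul_right, RCLike.re_ofReal_mul, inner_self_eq_norm_sq]
  rw [spectrum.notMem_iff, IsUnit.sub_iff]
  refine isUnit_of_forall_exists_add hsa hε fun u => ?_
  obtain ⟨v, w, hvw, hv, hw⟩ := h u
  exact ⟨v, w, hvw, by rw [hre]; linarith, by rw [hre]; linarith⟩

end SelfAdjoint

section SymmetricOperators

variable {𝕜 E : Type*} [RCLike 𝕜] [NormedAddCommGroup E] [InnerProductSpace 𝕜 E]
  [FiniteDimensional 𝕜 E] {n : ℕ} {A B : E →ₗ[𝕜] E}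

/-- The span of the eigenvectors of the symmetric operator `A` whose indices lie in `s`. The
indices refer to the eigenvalues listed in decreasing order. -/
noncomputable def eigenspan (hA : A.IsSymmetric) (hn : Module.finrank 𝕜 E = n)
    (s : Finset (Fin n)) : Submodule 𝕜 E :=
  Submodule.span 𝕜 (hA.eigenvectorBasis hn '' s)

variable (hA : A.IsSymmetric) (hB : B.IsSymmetric) (hn : Module.finrank 𝕜 E = n)

theorem finrank_eigenspan (s : Finset (Fin n)) :
    Module.finrank 𝕜 (eigenspan hA hn s) = s.card := by
  have hli := (hA.eigenvectorBasis hn).orthonormal.linearIndependent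
  rw [eigenspan, Set.image_eq_range]
  exact (finrank_span_eq_card (hli.comp _ Subtype.val_injective)).trans (Fintype.card_coe s)

theorem repr_eq_zero_of_mem_eigenspan {s : Finset (Fin n)} {x : E} (hx : x ∈ eigenspan hA hn s)
    {i : Fin n} (hi : i ∉ s) : (hA.eigenvectorBasis hn).repr x i = 0 := by
  have hmem := ((hA.eigenvectorBasis hn).toBasis.mem_span_image (m := x) (s := s)).1
    (by simpa [eigenspan] using hx)
  simpa using mt (@hmem i) hi

theorem re_inner_eq_sum_eigenvalues (x : E) : RCLike.re ⟪x, A x⟫_𝕜 =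
    ∑ i, hA.eigenvalues hn i * ‖(hA.eigenvectorBasis hn).repr x i‖ ^ 2 := by
  rw [← (hA.eigenvectorBasis hn).repr.inner_map_map, PiLp.inner_apply, map_sum]
  refine Finset.sum_congr rfl fun i _ => ?_
  rw [hA.eigenvectorBasis_apply_self_apply, RCLike.inner_apply, mul_assoc, RCLike.mul_conj,
    RCLike.re_ofReal_mul, ← RCLike.ofReal_pow, RCLike.ofReal_re]

theorem re_inner_le_of_mem_eigenspan {s : Finset (Fin n)} {μ : ℝ}
    (hs : ∀ i ∈ s, hA.eigenvalues hn i ≤ μ) {x : E} (hx : x ∈ eigenspan hA hn s) :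
    RCLike.re ⟪x, A x⟫_𝕜 ≤ μ * ‖x‖ ^ 2 := by
  rw [re_inner_eq_sum_eigenvalues hA hn, ← (hA.eigenvectorBasis hn).repr.norm_map x,
    EuclideanSpace.norm_sq_eq, Finset.mul_sum]
  refine Finset.sum_le_sum fun i _ => ?_
  by_cases hi : i ∈ s
  · exact mul_le_mul_of_nonneg_right (hs i hi) (sq_nonneg _)
  · simp [repr_eq_zero_of_mem_eigenspan hA hn hx hi]

theorem le_re_inner_of_mem_eigenspan {s : Finset (Fin n)} {μ : ℝ}
    (hs : ∀ i ∈ s, μ ≤ hA.eigenvalues hn i) {x : E} (hx : x ∈ eigenspan hA hn s) :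
    μ * ‖x‖ ^ 2 ≤ RCLike.re ⟪x, A x⟫_𝕜 := by
  rw [re_inner_eq_sum_eigenvalues hA hn, ← (hA.eigenvectorBasis hn).repr.norm_map x,
    EuclideanSpace.norm_sq_eq, Finset.mul_sum]
  refine Finset.sum_le_sum fun i _ => ?_
  by_cases hi : i ∈ s
  · exact mul_le_mul_of_nonneg_right (hs i hi) (sq_nonneg _)
  · simp [repr_eq_zero_of_mem_eigenspan hA hn hx hi]

theorem disjoint_eigenspan (hAB : A ≤ B) {s t : Finset (Fin n)} {μ ν : ℝ} (hμν : μ < ν)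
    (hs : ∀ i ∈ s, hB.eigenvalues hn i ≤ μ) (ht : ∀ i ∈ t, ν ≤ hA.eigenvalues hn i) :
    Disjoint (eigenspan hB hn s) (eigenspan hA hn t) := by
  rw [Submodule.disjoint_def]
  intro x hxB hxA
  have hle : RCLike.re ⟪x, A x⟫_𝕜 ≤ RCLike.re ⟪x, B x⟫_𝕜 := by
    simpa [inner_sub_right] using ((LinearMap.le_def _ _).1 hAB).re_inner_nonneg_right x
  have hsq : ν * ‖x‖ ^ 2 ≤ μ * ‖x‖ ^ 2 :=
    (le_re_inner_of_mem_eigenspan hA hn ht hxA).trans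
      (hle.trans (re_inner_le_of_mem_eigenspan hB hn hs hxB))
  by_contra hx
  exact hμν.not_ge (le_of_mul_le_mul_right hsq (by positivity))

theorem eigenvalues_mono (hAB : A ≤ B) (i : Fin n) :
    hA.eigenvalues hn i ≤ hB.eigenvalues hn i := by
  by_contra! hlt
  have hd := disjoint_eigenspan hA hB hn hAB (s := Finset.Ici i) (t := Finset.Iic i) hlt
    (fun j hj => hB.eigenvalues_antitone hn (Finset.mem_Ici.1 hj))
    (fun j hj => hA.eigenvalues_antitone hn (Finset.mem_Iic.1 hj))
  have hdim := Submodule.finrank_add_finrank_le_of_disjoint hd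
  rw [finrank_eigenspan, finrank_eigenspan, hn, Fin.card_Ici, Fin.card_Iic] at hdim
  omega

theorem isCompl_eigenspan (hAB : A ≤ B) {s : Finset (Fin n)} {μ ν : ℝ} (hμν : μ < ν)
    (hs : ∀ i ∈ s, hB.eigenvalues hn i ≤ μ) (ht : ∀ i ∉ s, ν ≤ hA.eigenvalues hn i) :
    IsCompl (eigenspan hB hn s) (eigenspan hA hn sᶜ) := by
  rw [Submodule.isCompl_iff_disjoint]
  · exact disjoint_eigenspan hA hB hn hAB hμν hs fun i hi => ht i (Finset.mem_compl.1 hi)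
  · rw [finrank_eigenspan, finrank_eigenspan, Finset.card_add_card_compl, Fintype.card_fin, hn]

theorem exists_pos_forall_le_sub_or_add_le {ι : Type*} [Finite ι] {a b : ι → ℝ} {x : ℝ}
    (h : ∀ i, b i < x ∨ x < a i) : ∃ ε > 0, ∀ i, b i ≤ x - ε ∨ x + ε ≤ a i := by
  have hev : ∀ᶠ ε in nhdsWithin (0 : ℝ) (Set.Ioi 0), ∀ i, b i ≤ x - ε ∨ x + ε ≤ a i := by
    refine Filter.eventually_all.2 fun i => ?_
    rcases h i with h | h
    · filter_upwards [Ioo_mem_nhdsGT (sub_pos.2 h)] with ε hε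
      exact Or.inl (by linarith [hε.2])
    · filter_upwards [Ioo_mem_nhdsGT (sub_pos.2 h)] with ε hε
      exact Or.inr (by linarith [hε.2])
  obtain ⟨ε, hε, hpos⟩ := (hev.and self_mem_nhdsWithin).exists
  exact ⟨ε, hpos, hε⟩

theorem exists_splitting (hAB : A ≤ B) {x : ℝ}
    (hx : ∀ i, hB.eigenvalues hn i < x ∨ x < hA.eigenvalues hn i) :
    ∃ ε > 0, ∃ P : E →ₗ[𝕜] E, ∀ u, RCLike.re ⟪P u, B (P u)⟫_𝕜 ≤ (x - ε) * ‖P u‖ ^ 2 ∧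
      (x + ε) * ‖u - P u‖ ^ 2 ≤ RCLike.re ⟪u - P u, A (u - P u)⟫_𝕜 := by
  classical
  obtain ⟨ε, hε, hgap⟩ := exists_pos_forall_le_sub_or_add_le hx
  let s : Finset (Fin n) := {i | hB.eigenvalues hn i ≤ x - ε}
  have hs : ∀ i ∈ s, hB.eigenvalues hn i ≤ x - ε := fun i hi => (Finset.mem_filter_univ i).1 hi
  have ht : ∀ i ∉ s, x + ε ≤ hA.eigenvalues hn i := fun i hi =>
    (hgap i).resolve_left fun h => hi ((Finset.mem_filter_univ i).2 h)
  have hc := isCompl_eigenspan hA hB hn hAB (by linarith : x - ε < x + ε) hs ht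
  refine ⟨ε, hε, Submodule.projection _ _ hc, fun u => ⟨?_, ?_⟩⟩
  · exact re_inner_le_of_mem_eigenspan hB hn hs (Submodule.projection_apply_mem hc u)
  · exact le_re_inner_of_mem_eigenspan hA hn (fun i hi => ht i (Finset.mem_compl.1 hi))
      (Submodule.sub_projection_mem hc u)

end SymmetricOperators

section Bracketing

variable {𝕜 κ E H : Type*} [RCLike 𝕜] [NormedAddCommGroup E] [InnerProductSpace 𝕜 E]
  [NormedAddCommGroup H] [InnerProductSpace 𝕜 H]

theorem hasSum_norm_sq {G : κ → Type*} [∀ k, NormedAddCommGroup (G k)] (f : lp G 2) :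
    HasSum (fun k => ‖f k‖ ^ 2) (‖f‖ ^ 2) := by
  simpa using lp.hasSum_norm (p := 2) (by norm_num) f

theorem exists_lp_apply_eq {p : ℝ≥0∞} (P : E →L[𝕜] E) (f : lp (fun _ : κ => E) p) :
    ∃ g : lp (fun _ : κ => E) p, ∀ k, g k = P (f k) :=
  ⟨⟨fun k => P (f k), ((lp.memℓp f).norm.const_mul ‖P‖).mono fun k => P.le_opNorm (f k)⟩,
    fun _ => rfl⟩

theorem summable_re_inner_apply (A : E →L[𝕜] E) (f : lp (fun _ : κ => E) 2) :
    Summable fun k => RCLike.re ⟪f k, A (f k)⟫_𝕜 := by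
  obtain ⟨g, hg⟩ := exists_lp_apply_eq A f
  simpa only [hg, RCLike.reCLM_apply] using (lp.summable_inner f g).mapL RCLike.reCLM

variable [FiniteDimensional 𝕜 E] [CompleteSpace H] {n : ℕ} {A B : E →ₗ[𝕜] E} {T : H →L[𝕜] H}

theorem spectrum_subset_iUnion_Icc (U : H ≃ₗᵢ[𝕜] lp (fun _ : κ => E) 2) (hT : IsSelfAdjoint T)
    (hA : A.IsSymmetric) (hB : B.IsSymmetric) (hn : Module.finrank 𝕜 E = n) (hAB : A ≤ B)
    (hAT : ∀ u, ∑' k, RCLike.re ⟪U u k, A (U u k)⟫_𝕜 ≤ RCLike.re ⟪u, T u⟫_𝕜)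
    (hTB : ∀ u, RCLike.re ⟪u, T u⟫_𝕜 ≤ ∑' k, RCLike.re ⟪U u k, B (U u k)⟫_𝕜) :
    {x : ℝ | (x : 𝕜) ∈ spectrum 𝕜 T} ⊆
      ⋃ i, Set.Icc (hA.eigenvalues hn i) (hB.eigenvalues hn i) := by
  intro x hx
  by_contra hout
  simp only [Set.mem_iUnion, Set.mem_Icc, not_exists, not_and_or, not_le] at hout
  obtain ⟨ε, hε, P, hP⟩ := exists_splitting hA hB hn hAB fun i => (hout i).symm
  refine ofReal_notMem_spectrum_of_forall_exists_add hT hε (fun u => ?_) hx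
  obtain ⟨f, hf⟩ : ∃ f : lp (fun _ : κ => E) 2, ∀ k, f k = P (U u k) :=
    exists_lp_apply_eq P.toContinuousLinearMap (U u)
  have hv : U (U.symm f) = f := U.apply_symm_apply f
  have hw (k : κ) : U (u - U.symm f) k = U u k - P (U u k) := by
    rw [map_sub, hv, lp.coeFn_sub, Pi.sub_apply, hf]
  refine ⟨U.symm f, u - U.symm f, add_sub_cancel _ _, (hTB _).trans ?_, le_trans ?_ (hAT _)⟩
  · rw [← U.norm_map]
    refine hasSum_le (fun k => ?_)
      (summable_re_inner_apply B.toContinuousLinearMap _).hasSum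
      ((hasSum_norm_sq _).mul_left (x - ε))
    simpa only [hv, hf, LinearMap.coe_toContinuousLinearMap'] using (hP (U u k)).1
  · rw [← U.norm_map]
    refine hasSum_le (fun k => ?_) ((hasSum_norm_sq _).mul_left (x + ε))
      (summable_re_inner_apply A.toContinuousLinearMap _).hasSum
    simpa only [hw, LinearMap.coe_toContinuousLinearMap'] using (hP (U u k)).2

theorem volume_spectrum_le_trace (U : H ≃ₗᵢ[𝕜] lp (fun _ : κ => E) 2) (hT : IsSelfAdjoint T)
    (hA : A.IsSymmetric) (hB : B.IsSymmetric) (hAB : A ≤ B)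
    (hAT : ∀ u, ∑' k, RCLike.re ⟪U u k, A (U u k)⟫_𝕜 ≤ RCLike.re ⟪u, T u⟫_𝕜)
    (hTB : ∀ u, RCLike.re ⟪u, T u⟫_𝕜 ≤ ∑' k, RCLike.re ⟪U u k, B (U u k)⟫_𝕜) :
    MeasureTheory.volume {x : ℝ | (x : 𝕜) ∈ spectrum 𝕜 T} ≤
      ENNReal.ofReal (RCLike.re (LinearMap.trace 𝕜 E (B - A))) := by
  calc MeasureTheory.volume {x : ℝ | (x : 𝕜) ∈ spectrum 𝕜 T}
      ≤ ∑ i, MeasureTheory.volume (Set.Icc (hA.eigenvalues rfl i) (hB.eigenvalues rfl i)) :=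
        (MeasureTheory.measure_mono
          (spectrum_subset_iUnion_Icc U hT hA hB rfl hAB hAT hTB)).trans
          (MeasureTheory.measure_iUnion_fintype_le _ _)
    _ = ENNReal.ofReal (∑ i, (hB.eigenvalues rfl i - hA.eigenvalues rfl i)) := by
        simp only [Real.volume_Icc]
        exact (ENNReal.ofReal_sum_of_nonneg fun i _ =>
          sub_nonneg.2 (eigenvalues_mono hA hB rfl hAB i)).symm
    _ = ENNReal.ofReal (RCLike.re (LinearMap.trace 𝕜 E (B - A))) := by
        rw [Finset.sum_sub_distrib, ← hA.re_trace_eq_sum_eigenvalues,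
          ← hB.re_trace_eq_sum_eigenvalues, map_sub, map_sub]

end Bracketing

section Curry

variable {𝕜 α κ ι : Type*} [RCLike 𝕜] [Fintype ι] (e : α ≃ κ × ι)

theorem memℓp_two_iff {G : κ → Type*} [∀ k, NormedAddCommGroup (G k)] {f : ∀ k, G k} :
    Memℓp f 2 ↔ Summable fun k => ‖f k‖ ^ 2 := by
  simpa using memℓp_gen_iff (p := 2) (f := f) (by norm_num)

theorem memℓp_curry_iff {u : α → 𝕜} :
    Memℓp (fun k => WithLp.toLp 2 fun i => u (e.symm (k, i)) : κ → EuclideanSpace 𝕜 ι) 2 ↔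
      Memℓp u 2 := by
  rw [memℓp_two_iff, memℓp_two_iff, ← e.symm.summable_iff,
    summable_prod_of_nonneg (f := (fun a => ‖u a‖ ^ 2) ∘ e.symm) fun _ => sq_nonneg _]
  simp only [Function.comp_apply, EuclideanSpace.norm_sq_eq, tsum_fintype]
  exact (and_iff_right fun _ => (hasSum_fintype _).summable).symm

/-- The identification of `ℓ²(α)` with the `ℓ²`-valued sum over `κ` of Euclidean spaces with index
set `ι`, for a partition of `α` into fibres encoded by `e : α ≃ κ × ι`. -/
noncomputable def lpCurry :
    lp (fun _ : α => 𝕜) 2 ≃ₗᵢ[𝕜] lp (fun _ : κ => EuclideanSpace 𝕜 ι) 2 where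
  toFun u := ⟨fun k => WithLp.toLp 2 fun i => u (e.symm (k, i)),
    (memℓp_curry_iff e).2 (lp.memℓp u)⟩
  invFun f := ⟨fun a => f (e a).1 (e a).2, (memℓp_curry_iff e).1 (by
    simpa only [Equiv.apply_symm_apply] using lp.memℓp f)⟩
  map_add' _ _ := rfl
  map_smul' _ _ := rfl
  left_inv u := by
    ext a
    exact congrArg u (e.symm_apply_apply a)
  right_inv f := by
    ext k i
    change f (e (e.symm (k, i))).1 (e (e.symm (k, i))).2 = f k i
    rw [e.apply_symm_apply]
  norm_map' u := by
    rw [← sq_eq_sq₀ (norm_nonneg _) (norm_nonneg _)]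
    refine (hasSum_norm_sq _).unique ?_
    refine (e.symm.hasSum_iff.2 (hasSum_norm_sq u)).prod_fiberwise fun k => ?_
    exact EuclideanSpace.norm_sq_eq (𝕜 := 𝕜) (n := ι) _ ▸ hasSum_fintype _

theorem lpCurry_apply (u : lp (fun _ : α => 𝕜) 2) (k : κ) (i : ι) :
    lpCurry e u k i = u (e.symm (k, i)) := rfl

end Curry

/-- The steps from a site of `ℤ²` to its four nearest neighbours. -/
def unitSteps : Finset (ℤ × ℤ) := {(0, -1), (0, 1), (-1, 0), (1, 0)}

theorem sum_unitSteps {M : Type*} [AddCommMonoid M] (f : ℤ × ℤ → M) :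
    ∑ s ∈ unitSteps, f s = f (0, -1) + f (0, 1) + f (-1, 0) + f (1, 0) := by
  simp [unitSteps, add_assoc]

theorem sum_unitSteps_neg {M : Type*} [AddCommMonoid M] (f : ℤ × ℤ → M) :
    ∑ s ∈ unitSteps, f (-s) = ∑ s ∈ unitSteps, f s := by
  simp only [sum_unitSteps, Prod.neg_mk, neg_zero, neg_neg]
  abel

theorem schrodinger_apply_eq_sum (q : ℤ → ℤ → ℝ) (hq : IsBoundedSeq q) (u : L2) (p : ℤ × ℤ) :
    schrodinger q hq u p = ∑ s ∈ unitSteps, u (p + s) + (q p.1 p.2 : ℂ) * u p := by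
  rw [sum_unitSteps]
  rfl

section Blocks

variable {κ ι : Type*} [DecidableEq κ] (e : ℤ × ℤ ≃ κ × ι)

/-- The steps from `p` to a neighbour in another block, where `e` numbers the blocks of a partition
of `ℤ²` by `κ` and the sites of each block by `ι`. -/
def crossingSteps (p : ℤ × ℤ) : Finset (ℤ × ℤ) := {s ∈ unitSteps | (e (p + s)).1 ≠ (e p).1}

theorem crossingSteps_subset (p : ℤ × ℤ) : crossingSteps e p ⊆ unitSteps :=
  Finset.filter_subset _ _

theorem hasSum_sum_crossingSteps_sub {f : ℤ × ℤ → ℝ} (hf : Summable f) :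
    HasSum (fun p => ∑ s ∈ crossingSteps e p, (f p - f (p + s))) 0 := by
  let F (s p : ℤ × ℤ) : ℝ := if (e (p + s)).1 ≠ (e p).1 then f p else 0
  have hF (s : ℤ × ℤ) : HasSum (F s) (∑' p, F s p) := by
    refine (hf.norm.of_norm_bounded fun p => ?_).hasSum
    simp only [F]
    split_ifs <;> simp
  have hF_neg (s : ℤ × ℤ) : HasSum (fun p => F (-s) (p + s)) (∑' p, F (-s) p) := by
    simpa only [Function.comp_def, Equiv.coe_addRight] using
      (Equiv.addRight s).hasSum_iff.2 (hF (-s))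
  have hsum := hasSum_sum (s := unitSteps) fun s _ => (hF s).sub (hF_neg s)
  rw [Finset.sum_sub_distrib, sum_unitSteps_neg fun s => ∑' p, F s p, sub_self] at hsum
  refine hsum.congr_fun fun p => ?_
  rw [crossingSteps, Finset.sum_filter]
  refine Finset.sum_congr rfl fun s _ => ?_
  simp only [F, add_neg_cancel_right, ne_comm (a := (e p).1)]
  split_ifs <;> simp

theorem summable_sum_crossingSteps_norm_sq (u : L2) (z : ℂ) :
    Summable fun p => ∑ s ∈ crossingSteps e p, ‖u (p + s) - z * u p‖ ^ 2 := by
  have hsum : Summable fun p => ∑ s ∈ unitSteps, ‖u (p + s) - z * u p‖ ^ 2 :=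
    summable_sum fun s _ => summable_sq (shift s u - z • u)
  exact hsum.of_nonneg_of_le (fun _ => Finset.sum_nonneg fun _ _ => sq_nonneg _) fun p =>
    Finset.sum_le_sum_of_subset_of_nonneg (crossingSteps_subset e p) fun _ _ _ => sq_nonneg _

theorem tsum_sum_crossingSteps_norm_sq_nonneg (u : L2) (z : ℂ) :
    0 ≤ ∑' p, ∑ s ∈ crossingSteps e p, ‖u (p + s) - z * u p‖ ^ 2 :=
  tsum_nonneg fun _ => Finset.sum_nonneg fun _ _ => sq_nonneg _

/-- The density at `p` of the energy of `u` for the operator decoupled along the block boundaries: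
each bond leaving the block of `p` is replaced by an on-site potential `σ`. -/
noncomputable def decoupledEnergy (q : ℤ → ℤ → ℝ) (σ : ℝ) (u : L2) (p : ℤ × ℤ) : ℝ :=
  ∑ s ∈ unitSteps \ crossingSteps e p, (⟪u p, u (p + s)⟫_ℂ).re +
    (q p.1 p.2 + σ * (crossingSteps e p).card) * ‖u p‖ ^ 2

variable {q : ℤ → ℤ → ℝ}

theorem re_inner_schrodinger_apply (hq : IsBoundedSeq q) (u : L2) (p : ℤ × ℤ) :
    (⟪u p, schrodinger q hq u p⟫_ℂ).re =
      ∑ s ∈ unitSteps, (⟪u p, u (p + s)⟫_ℂ).re + q p.1 p.2 * ‖u p‖ ^ 2 := by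
  rw [schrodinger_apply_eq_sum, inner_add_right, inner_sum, Complex.add_re, Complex.re_sum,
    ← smul_eq_mul, inner_smul_right, Complex.re_ofReal_mul, ← inner_self_eq_norm_sq (𝕜 := ℂ)]
  rfl

theorem decoupledEnergy_eq (hq : IsBoundedSeq q) {σ : ℝ} (hσ : σ ^ 2 = 1) (u : L2) (p : ℤ × ℤ) :
    decoupledEnergy e q σ u p = (⟪u p, schrodinger q hq u p⟫_ℂ).re +
      σ / 2 * ∑ s ∈ crossingSteps e p, ‖u (p + s) - σ * u p‖ ^ 2 +
      σ / 2 * ∑ s ∈ crossingSteps e p, (‖u p‖ ^ 2 - ‖u (p + s)‖ ^ 2) := by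
  have hbond (x y : ℂ) : σ * ‖x‖ ^ 2 =
      (⟪x, y⟫_ℂ).re + σ / 2 * ‖y - σ * x‖ ^ 2 + σ / 2 * (‖x‖ ^ 2 - ‖y‖ ^ 2) := by
    have hexpand : ‖y - σ * x‖ ^ 2 = ‖y‖ ^ 2 - 2 * (σ * (⟪x, y⟫_ℂ).re) + σ ^ 2 * ‖x‖ ^ 2 := by
      have hre : RCLike.re ⟪y, (σ : ℂ) * x⟫_ℂ = σ * (⟪x, y⟫_ℂ).re := by
        rw [inner_re_symm, ← smul_eq_mul, inner_smul_left, Complex.conj_ofReal]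
        exact Complex.re_ofReal_mul _ _
      rw [norm_sub_sq (𝕜 := ℂ), hre, norm_mul, Complex.norm_real, mul_pow, Real.norm_eq_abs,
        sq_abs]
    rw [hexpand]
    linear_combination ((⟪x, y⟫_ℂ).re - σ / 2 * ‖x‖ ^ 2) * hσ
  have hcross : σ * (crossingSteps e p).card * ‖u p‖ ^ 2 =
      ∑ s ∈ crossingSteps e p, (⟪u p, u (p + s)⟫_ℂ).re +
        σ / 2 * ∑ s ∈ crossingSteps e p, ‖u (p + s) - σ * u p‖ ^ 2 +
        σ / 2 * ∑ s ∈ crossingSteps e p, (‖u p‖ ^ 2 - ‖u (p + s)‖ ^ 2) := by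
    simp only [Finset.mul_sum, ← Finset.sum_add_distrib, ← hbond, Finset.sum_const, nsmul_eq_mul]
    ring
  rw [decoupledEnergy, add_mul, hcross, re_inner_schrodinger_apply,
    ← Finset.sum_sdiff (crossingSteps_subset e p)]
  ring

theorem hasSum_decoupledEnergy (hq : IsBoundedSeq q) {σ : ℝ} (hσ : σ ^ 2 = 1) (u : L2) :
    HasSum (decoupledEnergy e q σ u) ((⟪u, schrodinger q hq u⟫_ℂ).re +
      σ / 2 * ∑' p, ∑ s ∈ crossingSteps e p, ‖u (p + s) - σ * u p‖ ^ 2) := by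
  have henergy := Complex.hasSum_re (lp.hasSum_inner (𝕜 := ℂ) u (schrodinger q hq u))
  have hdefect := (summable_sum_crossingSteps_norm_sq e u σ).hasSum.mul_left (σ / 2)
  have hflux := (hasSum_sum_crossingSteps_sub e (summable_sq u)).mul_left (σ / 2)
  simpa only [← decoupledEnergy_eq e hq hσ, mul_zero, add_zero] using
    (henergy.add hdefect).add hflux

end Blocks

section BlockMatrix

variable {κ ι : Type*} [DecidableEq κ] [DecidableEq ι] (e : ℤ × ℤ ≃ κ × ι)
  (q : ℤ → ℤ → ℝ)

/-- The matrix on block `k` of the operator decoupled along the block boundaries: each bond leaving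
the block is replaced by an on-site potential `σ`. Off the diagonal it counts the unit steps between
two sites of the block. -/
noncomputable def blockMatrix (σ : ℝ) (k : κ) : Matrix ι ι ℂ :=
  .of (fun i j => (Finset.card {s ∈ unitSteps | e.symm (k, i) + s = e.symm (k, j)} : ℂ)) +
    .diagonal fun i => ((q (e.symm (k, i)).1 (e.symm (k, i)).2 +
      σ * (crossingSteps e (e.symm (k, i))).card : ℝ) : ℂ)

theorem isHermitian_blockMatrix (σ : ℝ) (k : κ) : (blockMatrix e q σ k).IsHermitian := by
  refine .add (.ext fun i j => ?_) (Matrix.isHermitian_diagonal_of_self_adjoint _ ?_)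
  · simp only [Matrix.of_apply, star_natCast, Finset.card_filter]
    rw [← sum_unitSteps_neg]
    simp only [add_neg_eq_iff_eq_add, eq_comm (a := e.symm (k, j))]
  · exact funext fun i => Complex.conj_ofReal _

theorem blockMatrix_sub_blockMatrix (σ τ : ℝ) (k : κ) :
    blockMatrix e q σ k - blockMatrix e q τ k =
      .diagonal fun i => (((σ - τ) * (crossingSteps e (e.symm (k, i))).card : ℝ) : ℂ) := by
  rw [blockMatrix, blockMatrix, add_sub_add_left_eq_sub, Matrix.diagonal_sub]
  congr 1
  ext i
  push_cast
  ring

variable {q} in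
theorem blockMatrix_eq {k k₀ : κ} {t : ℤ × ℤ}
    (ht : ∀ i, e.symm (k, i) = e.symm (k₀, i) + t)
    (hq : ∀ i, q (e.symm (k, i)).1 (e.symm (k, i)).2 = q (e.symm (k₀, i)).1 (e.symm (k₀, i)).2)
    (σ : ℝ) : blockMatrix e q σ k = blockMatrix e q σ k₀ := by
  have hstep (i j : ι) (s : ℤ × ℤ) :
      e.symm (k, i) + s = e.symm (k, j) ↔ e.symm (k₀, i) + s = e.symm (k₀, j) := by
    rw [ht, ht, add_right_comm, add_left_inj]
  have hmem (k : κ) (p : ℤ × ℤ) : (e p).1 = k ↔ ∃ j, p = e.symm (k, j) := by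
    simp only [e.eq_symm_apply, Prod.ext_iff, exists_and_left, exists_eq', and_true]
  have hcrossing (i : ι) :
      crossingSteps e (e.symm (k, i)) = crossingSteps e (e.symm (k₀, i)) :=
    Finset.filter_congr fun s _ => by
      simp only [e.apply_symm_apply, ne_eq, hmem, hstep]
  simp only [blockMatrix, hstep, hcrossing, hq]

variable [Fintype ι]

theorem blockMatrix_mulVec (σ : ℝ) (u : ℤ × ℤ → ℂ) (k : κ) (i : ι) :
    (blockMatrix e q σ k).mulVec (fun j => u (e.symm (k, j))) i =
      ∑ s ∈ unitSteps \ crossingSteps e (e.symm (k, i)), u (e.symm (k, i) + s) +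
        ((q (e.symm (k, i)).1 (e.symm (k, i)).2 +
          σ * (crossingSteps e (e.symm (k, i))).card : ℝ) : ℂ) * u (e.symm (k, i)) := by
  rw [blockMatrix, Matrix.add_mulVec, Pi.add_apply, Matrix.mulVec_diagonal]
  congr 1
  have hfiber (p : ℤ × ℤ) : ∑ j, (if p = e.symm (k, j) then u (e.symm (k, j)) else 0) =
      if (e p).1 = k then u p else 0 := by
    obtain ⟨⟨k', i'⟩, rfl⟩ := e.symm.surjective p
    by_cases hk : k' = k <;> simp [hk]
  simp only [Matrix.mulVec, dotProduct, Matrix.of_apply, Finset.card_filter, Nat.cast_sum,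
    Nat.cast_ite, Nat.cast_one, Nat.cast_zero, Finset.sum_mul, ite_mul, one_mul, zero_mul]
  rw [Finset.sum_comm, crossingSteps, Finset.filter_not, sdiff_sdiff_right_self]
  simp only [hfiber, e.apply_symm_apply, Finset.inf_eq_inter, Finset.inter_filter,
    Finset.inter_self, Finset.sum_filter]

theorem re_inner_blockMatrix (σ : ℝ) (u : L2) (k : κ) :
    (⟪lpCurry e u k, (blockMatrix e q σ k).toEuclideanLin (lpCurry e u k)⟫_ℂ).re =
      ∑ i, decoupledEnergy e q σ u (e.symm (k, i)) := by
  rw [PiLp.inner_apply, Complex.re_sum]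
  refine Finset.sum_congr rfl fun i _ => ?_
  have happly : (blockMatrix e q σ k).toEuclideanLin (lpCurry e u k) i =
      (blockMatrix e q σ k).mulVec (fun j => u (e.symm (k, j))) i := rfl
  rw [happly, blockMatrix_mulVec, lpCurry_apply, decoupledEnergy, inner_add_right, inner_sum,
    Complex.add_re, Complex.re_sum, ← smul_eq_mul, inner_smul_right, Complex.re_ofReal_mul,
    ← inner_self_eq_norm_sq (𝕜 := ℂ)]
  rfl

variable {q}

theorem tsum_re_inner_blockMatrix (hq : IsBoundedSeq q) {σ : ℝ} (hσ : σ ^ 2 = 1) (u : L2) :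
    ∑' k, (⟪lpCurry e u k, (blockMatrix e q σ k).toEuclideanLin (lpCurry e u k)⟫_ℂ).re =
      (⟪u, schrodinger q hq u⟫_ℂ).re +
        σ / 2 * ∑' p, ∑ s ∈ crossingSteps e p, ‖u (p + s) - σ * u p‖ ^ 2 := by
  simp only [re_inner_blockMatrix]
  exact ((e.symm.hasSum_iff.2 (hasSum_decoupledEnergy e hq hσ u)).prod_fiberwise
    fun _ => hasSum_fintype _).tsum_eq

theorem re_inner_schrodinger_le_tsum_blockMatrix (hq : IsBoundedSeq q) (u : L2) :
    (⟪u, schrodinger q hq u⟫_ℂ).re ≤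
      ∑' k, (⟪lpCurry e u k, (blockMatrix e q 1 k).toEuclideanLin (lpCurry e u k)⟫_ℂ).re := by
  rw [tsum_re_inner_blockMatrix e hq (one_pow 2)]
  linarith [tsum_sum_crossingSteps_norm_sq_nonneg e u (1 : ℝ)]

theorem tsum_blockMatrix_le_re_inner_schrodinger (hq : IsBoundedSeq q) (u : L2) :
    ∑' k, (⟪lpCurry e u k, (blockMatrix e q (-1) k).toEuclideanLin (lpCurry e u k)⟫_ℂ).re ≤
      (⟪u, schrodinger q hq u⟫_ℂ).re := by
  rw [tsum_re_inner_blockMatrix e hq neg_one_sq]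
  linarith [tsum_sum_crossingSteps_norm_sq_nonneg e u (-1 : ℝ)]

theorem toEuclideanLin_blockMatrix_mono {σ τ : ℝ} (h : σ ≤ τ) (k : κ) :
    (blockMatrix e q σ k).toEuclideanLin ≤ (blockMatrix e q τ k).toEuclideanLin := by
  rw [LinearMap.le_def, ← map_sub, Matrix.isPositive_toEuclideanLin_iff,
    blockMatrix_sub_blockMatrix]
  exact .diagonal fun i =>
    Complex.zero_le_real.2 (mul_nonneg (sub_nonneg.2 h) (Nat.cast_nonneg _))

theorem re_trace_toEuclideanLin_blockMatrix_sub (σ τ : ℝ) (k : κ) :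
    (LinearMap.trace ℂ _ ((blockMatrix e q σ k).toEuclideanLin -
      (blockMatrix e q τ k).toEuclideanLin)).re =
      (σ - τ) * ∑ i, (crossingSteps e (e.symm (k, i))).card := by
  rw [← map_sub, blockMatrix_sub_blockMatrix, Matrix.toEuclideanLin,
    Matrix.toLpLin_eq_toLin, Matrix.trace_toLin_eq, Matrix.trace_diagonal,
    ← Complex.ofReal_sum, Complex.ofReal_re, ← Finset.mul_sum, Nat.cast_sum]

omit [DecidableEq ι] in
theorem volume_realSpectrum_le_sum_crossingSteps (hb : IsBoundedSeq q) (k₀ : κ) (t : κ → ℤ × ℤ)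
    (ht : ∀ k i, e.symm (k, i) = e.symm (k₀, i) + t k)
    (hq : ∀ k i, q (e.symm (k, i)).1 (e.symm (k, i)).2 =
      q (e.symm (k₀, i)).1 (e.symm (k₀, i)).2) :
    MeasureTheory.volume (realSpectrum (schrodinger q hb)) ≤
      2 * ∑ i, (crossingSteps e (e.symm (k₀, i))).card := by
  classical
  have hblock (σ : ℝ) (k : κ) : blockMatrix e q σ k = blockMatrix e q σ k₀ :=
    blockMatrix_eq e (ht k) (hq k) σ
  have hlower (u : L2) := tsum_blockMatrix_le_re_inner_schrodinger e hb u
  have hupper (u : L2) := re_inner_schrodinger_le_tsum_blockMatrix e hb u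
  simp only [hblock] at hlower hupper
  have hsymm (σ : ℝ) := Matrix.isSymmetric_toEuclideanLin_iff.2 (isHermitian_blockMatrix e q σ k₀)
  refine (volume_spectrum_le_trace (lpCurry e) (schrodinger_isSelfAdjoint q hb) (hsymm (-1))
    (hsymm 1) (toEuclideanLin_blockMatrix_mono e (by norm_num) k₀) hlower hupper).trans_eq ?_
  rw [RCLike.re_eq_complex_re, re_trace_toEuclideanLin_blockMatrix_sub, sub_neg_eq_add,
    one_add_one_eq_two]
  norm_cast

end BlockMatrix

section Cells

variable (N M : ℕ) [NeZero N] [NeZero M]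

/-- The partition of `ℤ²` into rectangles of size `N × M`: a site is given by the index of its
rectangle and by its position there. -/
def cellEquiv : ℤ × ℤ ≃ (ℤ × ℤ) × (Fin N × Fin M) :=
  ((Int.divModEquiv N).prodCongr (Int.divModEquiv M)).trans (Equiv.prodProdProdComm _ _ _ _)

theorem cellEquiv_symm_apply (c : ℤ × ℤ) (i : Fin N × Fin M) :
    (cellEquiv N M).symm (c, i) = (c.1 * N + (i.1 : ℕ), c.2 * M + (i.2 : ℕ)) := rfl

theorem cellEquiv_apply_fst (p : ℤ × ℤ) : (cellEquiv N M p).1 = (p.1 / N, p.2 / M) := rfl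

theorem card_filter_add_ediv_ne_zero (K : ℕ) [NeZero K] {s : ℤ} (hs : |s| = 1) :
    Finset.card {k : Fin K | ((k : ℕ) + s) / (K : ℤ) ≠ 0} = 1 := by
  have hK := Nat.pos_of_neZero K
  have hdiv (k : Fin K) : ((k : ℕ) + s) / (K : ℤ) = 0 ↔ 0 ≤ (k : ℕ) + s ∧ (k : ℕ) + s < K := by
    rw [Int.ediv_eq_iff_of_pos (by exact_mod_cast hK), zero_mul, zero_add]
  rw [Finset.card_eq_one]
  rcases (abs_eq zero_le_one).1 hs with rfl | rfl
  · refine ⟨⟨K - 1, by omega⟩, Finset.ext fun k => ?_⟩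
    simp only [Finset.mem_filter_univ, Finset.mem_singleton, Fin.ext_iff, ne_eq, hdiv]
    omega
  · refine ⟨⟨0, hK⟩, Finset.ext fun k => ?_⟩
    simp only [Finset.mem_filter_univ, Finset.mem_singleton, Fin.ext_iff, ne_eq, hdiv]
    omega

theorem sum_card_crossingSteps_cellEquiv :
    ∑ i, (crossingSteps (cellEquiv N M) ((cellEquiv N M).symm (0, i))).card = 2 * (N + M) := by
  have hzero (K : ℕ) (k : Fin K) : ((k : ℕ) : ℤ) / (K : ℤ) = 0 :=
    Int.ediv_eq_zero_of_lt (Int.natCast_nonneg _) (by exact_mod_cast k.isLt)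
  have hcrossing (i : Fin N × Fin M) (s : ℤ × ℤ) :
      (cellEquiv N M ((cellEquiv N M).symm (0, i) + s)).1 ≠
        (cellEquiv N M ((cellEquiv N M).symm (0, i))).1 ↔
      ((i.1 : ℕ) + s.1) / (N : ℤ) ≠ 0 ∨ ((i.2 : ℕ) + s.2) / (M : ℤ) ≠ 0 := by
    simp [cellEquiv_apply_fst, cellEquiv_symm_apply, Prod.ext_iff, hzero, imp_iff_not_or]
  have hfst {s : ℤ} (hs : |s| = 1) :
      ∑ i : Fin N × Fin M, (if ((i.1 : ℕ) + s) / (N : ℤ) ≠ 0 then 1 else 0) = M := by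
    rw [Fintype.sum_prod_type_right]
    simp only [← Finset.card_filter, card_filter_add_ediv_ne_zero N hs, Finset.sum_const,
      Finset.card_univ, Fintype.card_fin, smul_eq_mul, mul_one]
  have hsnd {s : ℤ} (hs : |s| = 1) :
      ∑ i : Fin N × Fin M, (if ((i.2 : ℕ) + s) / (M : ℤ) ≠ 0 then 1 else 0) = N := by
    rw [Fintype.sum_prod_type]
    simp only [← Finset.card_filter, card_filter_add_ediv_ne_zero M hs, Finset.sum_const,
      Finset.card_univ, Fintype.card_fin, smul_eq_mul, mul_one]
  simp only [crossingSteps, Finset.card_filter]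
  rw [Finset.sum_comm, sum_unitSteps]
  simp only [hcrossing, add_zero, hzero, ne_eq, not_true_eq_false, false_or, or_false]
  rw [hsnd rfl, hsnd rfl, hfst rfl, hfst rfl]
  ring

variable {N M}

theorem IsPeriodic.apply_cellEquiv_symm {q : ℤ → ℤ → ℝ} (hq : IsPeriodic N M q) (c : ℤ × ℤ)
    (i : Fin N × Fin M) :
    q ((cellEquiv N M).symm (c, i)).1 ((cellEquiv N M).symm (c, i)).2 =
      q ((cellEquiv N M).symm (0, i)).1 ((cellEquiv N M).symm (0, i)).2 := by
  have hfst (m : ℤ) : Function.Periodic (fun n => q n m) (N : ℤ) := fun n => hq.1 n m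
  have hsnd (n : ℤ) : Function.Periodic (fun m => q n m) (M : ℤ) := fun m => hq.2 n m
  have hfst_mul := (hfst (c.2 * M + (i.2 : ℕ))).int_mul c.1 ((i.1 : ℕ) : ℤ)
  have hsnd_mul := (hsnd ((i.1 : ℕ) : ℤ)).int_mul c.2 ((i.2 : ℕ) : ℤ)
  simp only [Int.cast_id] at hfst_mul hsnd_mul
  simp only [cellEquiv_symm_apply, Prod.fst_zero, Prod.snd_zero, zero_mul, zero_add]
  rw [add_comm (c.1 * (N : ℤ)), hfst_mul, add_comm (c.2 * (M : ℤ)), hsnd_mul]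

theorem volume_realSpectrum_le {q : ℤ → ℤ → ℝ} (hq : IsPeriodic N M q) (hb : IsBoundedSeq q) :
    MeasureTheory.volume (realSpectrum (schrodinger q hb)) ≤ 4 * ((N : ℝ≥0∞) + M) := by
  refine (volume_realSpectrum_le_sum_crossingSteps (cellEquiv N M) hb 0
    (fun c => (c.1 * N, c.2 * M)) (fun c i => ?_) hq.apply_cellEquiv_symm).trans_eq ?_
  · simp [cellEquiv_symm_apply, add_comm]
  · rw [sum_card_crossingSteps_cellEquiv]
    push_cast
    ring

end Cells

section ApproximateEigenvector

variable {𝕜 H : Type*} [RCLike 𝕜] [NormedAddCommGroup H] [NormedSpace 𝕜 H]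

theorem mem_spectrum_of_forall_exists_norm_le {T : H →L[𝕜] H} {z : 𝕜}
    (h : ∀ ε > 0, ∃ u ≠ 0, ‖T u - z • u‖ ≤ ε * ‖u‖) : z ∈ spectrum 𝕜 T := by
  rw [spectrum.mem_iff, ← IsUnit.neg_iff, neg_sub]
  intro hunit
  obtain ⟨c, hc, hbound⟩ := antilipschitzWith_iff_exists_mul_le_norm.1
    (ContinuousLinearMap.antilipschitz_of_isEmbedding _
      (ContinuousLinearMap.isHomeomorph_of_isUnit hunit).isEmbedding)
  obtain ⟨u, hu, hle⟩ := h (c / 2) (half_pos hc)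
  have hu' : 0 < ‖u‖ := norm_pos_iff.2 hu
  have hcu : c * ‖u‖ ≤ c / 2 * ‖u‖ := (hbound u).trans hle
  nlinarith

end ApproximateEigenvector

section ConstantPotential

theorem summable_pow_natAbs {r : ℝ} (h0 : 0 ≤ r) (h1 : r < 1) :
    Summable fun n : ℤ => r ^ n.natAbs := by
  refine Summable.of_nat_of_neg ?_ ?_ <;>
    simpa only [Int.natAbs_neg, Int.natAbs_natCast] using summable_geometric_of_lt_one h0 h1

/-- The plane wave with phase `z` per unit step, damped exponentially so as to lie in `ℓ²(ℤ²)`. -/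
noncomputable def dampedWave (r : ℝ) (z : Circle) (p : ℤ × ℤ) : ℂ :=
  (r ^ (p.1.natAbs + p.2.natAbs) : ℝ) * (z ^ (p.1 + p.2) : Circle)

theorem norm_dampedWave {r : ℝ} (h0 : 0 ≤ r) (z : Circle) (p : ℤ × ℤ) :
    ‖dampedWave r z p‖ = r ^ (p.1.natAbs + p.2.natAbs) := by
  rw [dampedWave, norm_mul, Circle.norm_coe, mul_one, Complex.norm_of_nonneg (by positivity)]

theorem memℓp_dampedWave {r : ℝ} (h0 : 0 ≤ r) (h1 : r < 1) (z : Circle) :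
    Memℓp (dampedWave r z) 2 := by
  refine memℓp_two ?_
  have hgeom := summable_pow_natAbs (sq_nonneg r) (pow_lt_one₀ h0 h1 two_ne_zero)
  refine (hgeom.mul_of_nonneg hgeom (fun _ => by positivity) fun _ => by positivity).congr
    fun p => ?_
  rw [norm_dampedWave h0, ← pow_add, ← pow_mul, ← pow_mul, mul_comm]

theorem abs_pow_sub_pow_le {r : ℝ} (h0 : 0 < r) (h1 : r ≤ 1) {j k : ℕ} (hjk : j ≤ k + 1)
    (hkj : k ≤ j + 1) : |r ^ j - r ^ k| ≤ (r⁻¹ - 1) * r ^ k := by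
  have hr : 0 ≤ r⁻¹ - 1 := sub_nonneg.2 ((one_le_inv₀ h0).2 h1)
  rcases lt_trichotomy j k with h | rfl | h
  · obtain rfl : k = j + 1 := by omega
    have hpow : (r⁻¹ - 1) * r ^ (j + 1) = r ^ j - r ^ (j + 1) := by
      field_simp
      ring
    rw [hpow, abs_of_nonneg (sub_nonneg.2 (pow_le_pow_of_le_one h0.le h1 j.le_succ))]
  · rw [sub_self, abs_zero]
    positivity
  · obtain rfl : j = k + 1 := by omega
    have hpow : r ^ k - r ^ (k + 1) = r * ((r⁻¹ - 1) * r ^ k) := by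
      field_simp
      ring
    rw [abs_sub_comm, abs_of_nonneg (sub_nonneg.2 (pow_le_pow_of_le_one h0.le h1 k.le_succ)),
      hpow]
    exact mul_le_of_le_one_left (by positivity) h1

theorem natAbs_add_natAbs_of_mem_unitSteps {s : ℤ × ℤ} (hs : s ∈ unitSteps) :
    s.1.natAbs + s.2.natAbs = 1 := by
  simp only [unitSteps, Finset.mem_insert, Finset.mem_singleton] at hs
  rcases hs with rfl | rfl | rfl | rfl <;> rfl

theorem norm_dampedWave_add_sub_le {r : ℝ} (h0 : 0 < r) (h1 : r ≤ 1) (z : Circle) (p : ℤ × ℤ)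
    {s : ℤ × ℤ} (hs : s ∈ unitSteps) :
    ‖dampedWave r z (p + s) - (z ^ (s.1 + s.2) : Circle) * dampedWave r z p‖ ≤
      (r⁻¹ - 1) * ‖dampedWave r z p‖ := by
  have hs1 := natAbs_add_natAbs_of_mem_unitSteps hs
  have hfactor : dampedWave r z (p + s) - (z ^ (s.1 + s.2) : Circle) * dampedWave r z p =
      ((r ^ ((p + s).1.natAbs + (p + s).2.natAbs) - r ^ (p.1.natAbs + p.2.natAbs) : ℝ) : ℂ) *
        (z ^ ((p + s).1 + (p + s).2) : Circle) := by
    rw [dampedWave, dampedWave, Prod.fst_add, Prod.snd_add, add_add_add_comm p.1 s.1, zpow_add,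
      Circle.coe_mul]
    push_cast
    ring
  rw [hfactor, norm_mul, Circle.norm_coe, mul_one, Complex.norm_real, Real.norm_eq_abs,
    norm_dampedWave h0.le]
  refine abs_pow_sub_pow_le h0 h1 ?_ ?_ <;>
  · simp only [Prod.fst_add, Prod.snd_add]
    omega

theorem sum_unitSteps_zpow (z : Circle) :
    ∑ s ∈ unitSteps, ((z ^ (s.1 + s.2) : Circle) : ℂ) = (4 * (z : ℂ).re : ℝ) := by
  rw [sum_unitSteps]
  have hre := Complex.add_conj (z : ℂ)
  simp only [zero_add, add_zero, zpow_neg_one, zpow_one, Circle.coe_inv_eq_conj]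
  push_cast at hre ⊢
  linear_combination 2 * hre

variable {q : ℤ → ℤ → ℝ}

theorem norm_schrodinger_apply_dampedWave_sub_le (hq : IsBoundedSeq q) {c : ℝ}
    (hc : ∀ n m, q n m = c) {r : ℝ} (h0 : 0 < r) (h1 : r < 1) {z : Circle} {u : L2}
    (hu : ⇑u = dampedWave r z) (p : ℤ × ℤ) :
    ‖schrodinger q hq u p - ((c + 4 * (z : ℂ).re : ℝ) : ℂ) * u p‖ ≤ 4 * (r⁻¹ - 1) * ‖u p‖ := by
  have hsum : schrodinger q hq u p - ((c + 4 * (z : ℂ).re : ℝ) : ℂ) * u p =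
      ∑ s ∈ unitSteps, (u (p + s) - (z ^ (s.1 + s.2) : Circle) * u p) := by
    rw [schrodinger_apply_eq_sum, hc, Finset.sum_sub_distrib, ← Finset.sum_mul,
      sum_unitSteps_zpow, Complex.ofReal_add]
    ring
  rw [hsum]
  calc ‖∑ s ∈ unitSteps, (u (p + s) - (z ^ (s.1 + s.2) : Circle) * u p)‖
      ≤ ∑ _s ∈ unitSteps, (r⁻¹ - 1) * ‖u p‖ :=
        norm_sum_le_of_le _ fun s hs => hu ▸ norm_dampedWave_add_sub_le h0 h1.le z p hs
    _ = 4 * (r⁻¹ - 1) * ‖u p‖ := by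
        rw [Finset.sum_const, show unitSteps.card = 4 from rfl, nsmul_eq_mul, mul_assoc]
        norm_num

theorem add_four_mul_re_mem_realSpectrum (hq : IsBoundedSeq q) {c : ℝ} (hc : ∀ n m, q n m = c)
    (z : Circle) : c + 4 * (z : ℂ).re ∈ realSpectrum (schrodinger q hq) := by
  refine mem_spectrum_of_forall_exists_norm_le fun ε hε => ?_
  obtain ⟨r, h0, h1, hr⟩ : ∃ r : ℝ, 0 < r ∧ r < 1 ∧ 4 * (r⁻¹ - 1) = ε := by
    refine ⟨(1 + ε / 4)⁻¹, by positivity, inv_lt_one_of_one_lt₀ (by linarith), ?_⟩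
    rw [inv_inv]
    ring
  let u : L2 := ⟨dampedWave r z, memℓp_dampedWave h0.le h1 z⟩
  have hu : u ≠ 0 := fun hzero => by
    have hnorm : ‖u 0‖ = 1 := norm_dampedWave h0.le z 0
    rw [hzero] at hnorm
    simp at hnorm
  have hsmul {E : Type} [NormedAddCommGroup E] [NormedSpace ℂ E] (x : E) :
      ‖(ε : ℂ) • x‖ = ε * ‖x‖ := by
    rw [norm_smul, Complex.norm_of_nonneg hε.le]
  refine ⟨u, hu, hsmul u ▸ lp.norm_mono two_ne_zero fun p => ?_⟩
  calc ‖(schrodinger q hq u - ((c + 4 * (z : ℂ).re : ℝ) : ℂ) • u) p‖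
      ≤ 4 * (r⁻¹ - 1) * ‖u p‖ :=
        norm_schrodinger_apply_dampedWave_sub_le hq hc h0 h1 rfl p
    _ = ‖((ε : ℂ) • u) p‖ := by rw [hr, ← hsmul]; rfl

theorem Icc_subset_realSpectrum (hq : IsBoundedSeq q) {c : ℝ} (hc : ∀ n m, q n m = c) :
    Set.Icc (c - 4) (c + 4) ⊆ realSpectrum (schrodinger q hq) := by
  intro x hx
  have hre : ((Circle.exp (Real.arccos ((x - c) / 4)) : Circle) : ℂ).re = (x - c) / 4 := by
    rw [Circle.coe_exp, Complex.exp_ofReal_mul_I_re,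
      Real.cos_arccos (by linarith [hx.1]) (by linarith [hx.2])]
  have hmem := add_four_mul_re_mem_realSpectrum hq hc (Circle.exp (Real.arccos ((x - c) / 4)))
  rwa [hre, mul_div_cancel₀ _ four_ne_zero, add_sub_cancel] at hmem

end ConstantPotential

end DiscreteSchrodinger

theorem theorem1p3 :
    (∀ (N M : ℕ) (hN : 0 < N) (hM : 0 < M) (q : ℤ → ℤ → ℝ)
        (hq : DiscreteSchrodinger.IsPeriodic N M q),
      MeasureTheory.volume (DiscreteSchrodinger.realSpectrum
        (DiscreteSchrodinger.schrodinger q (hq.isBoundedSeq hN hM))) ≤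
          4 * ((N : ENNReal) + (M : ENNReal))) ∧
    (∀ (q : ℤ → ℤ → ℝ) (hq : DiscreteSchrodinger.IsPeriodic 1 1 q),
      (∃ c : ℝ, ∀ n m : ℤ, q n m = c) →
      MeasureTheory.volume (DiscreteSchrodinger.realSpectrum
        (DiscreteSchrodinger.schrodinger q (hq.isBoundedSeq one_pos one_pos))) =
          4 * (((1 : ℕ) : ENNReal) + ((1 : ℕ) : ENNReal))) := by
  refine ⟨fun N M hN hM q hq => ?_, fun q hq ⟨c, hc⟩ => le_antisymm ?_ ?_⟩
  · have : NeZero N := ⟨hN.ne'⟩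
    have : NeZero M := ⟨hM.ne'⟩
    exact DiscreteSchrodinger.volume_realSpectrum_le hq _
  · exact DiscreteSchrodinger.volume_realSpectrum_le hq _
  · calc (4 * (((1 : ℕ) : ENNReal) + ((1 : ℕ) : ENNReal)))
        = MeasureTheory.volume (Set.Icc (c - 4) (c + 4)) := by
          rw [Real.volume_Icc, show c + 4 - (c - 4) = ((8 : ℕ) : ℝ) by norm_num,
            ENNReal.ofReal_natCast]
          norm_num
      _ ≤ _ := MeasureTheory.measure_mono
          (DiscreteSchrodinger.Icc_subset_realSpectrum _ hc)
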